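/- A group $\Gamma$ is called Jordan if there is a constant $J$ such that every finite subgroup $G\subset\Gamma$ has a normal abelian subgroup of index at most $J$. The weak Jordan constant $\bar J(\Gamma)$ of a Jordan group $\Gamma$ is the minimal number $\bar J$ such that every finite subgroup $G\subset\Gamma$ has a (not necessarily normal) abelian subgroup of index at most $\bar J$. Let $\Bbbk$ be an algebraically closed field of characteristic $0$. Then $\mathrm{GL}_2(\Bbbk)$ and $\mathrm{PGL}_2(\Bbbk)$ are Jordan groups and $$\bar J(\mathrm{GL}_2(\Bbbk))=\bar J(\mathrm{PGL}_2(\Bbbk))=12.$$ The value for $\mathrm{GL}_2(\Bbbk)$ is attained by the group $2.\mathfrak A_5$, and the value for $\mathrm{PGL}_2(\Bbbk)$ by the group $\mathfrak A_5$. That is, $\mathrm{GL}_2(\Bbbk)$ contains a subgroup that is a central extension of $\mathfrak A_5$ by a cyclic group of order $2$ and is not isomorphic to $\mathfrak A_5\times\mathbb Z/2$, and for every subgroup of $\mathrm{GL}_2(\Bbbk)$ that is a central extension of $\mathfrak A_5$ by a cyclic group of order $2$ the minimal index of an abelian subgroup equals $12$; and $\mathrm{PGL}_2(\Bbbk)$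 contains a subgroup isomorphic to $\mathfrak A_5$, and for every such subgroup the minimal index of an abelian subgroup equals $12$. -/

import Mathlib

open scoped MatrixGroups

/-- `Γ` is a Jordan group: for some constant `J`, every finite subgroup `G` of `Γ` has a normal
abelian subgroup of index at most `J`. -/
def IsJordanGroup (Γ : Type*) [Group Γ] : Prop :=
  ∃ J : ℕ, ∀ G : Subgroup Γ, Finite G →
    ∃ A : Subgroup G, A.Normal ∧ IsMulCommutative A ∧ A.index ≤ J

/-- Every finite subgroup `G` of `Γ` has a (not necessarily normal) abelian subgroup of index
at most `J`. -/
def IsWeakJordanBound (Γ : Type*) [Group Γ] (J : ℕ) : Prop :=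
  ∀ G : Subgroup Γ, Finite G → ∃ A : Subgroup G, IsMulCommutative A ∧ A.index ≤ J

/-- `Γ` is a Jordan group and its weak Jordan constant is `J`, that is, `J` is the minimal number
such that every finite subgroup of `Γ` has an abelian subgroup of index at most `J`. -/
def IsWeakJordanConstant (Γ : Type*) [Group Γ] (J : ℕ) : Prop :=
  IsJordanGroup Γ ∧ IsLeast {n : ℕ | IsWeakJordanBound Γ n} J

/-- The smallest (finite) index of an abelian subgroup of the group `G` is `m`. -/
def IsMinAbelianIndex (G : Type*) [Group G] (m : ℕ) : Prop :=
  IsLeast {n : ℕ | ∃ A : Subgroup G, IsMulCommutative A ∧ A.FiniteIndex ∧ A.index = n} m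

/-- `E` is a group of the form `m.Γ`: a central extension of `Γ` by a cyclic group of
order `m`. -/
def IsCentralExtensionByCyclic (m : ℕ) (E Γ : Type*) [Group E] [Group Γ] : Prop :=
  ∃ φ : E →* Γ, Function.Surjective φ ∧ φ.ker ≤ Subgroup.center E ∧
    IsCyclic φ.ker ∧ Nat.card φ.ker = m

/-! Upper bound: a finite subgroup of `PGL(2, k)` acts on the projective line, and each nontrivial
element, being of finite order in characteristic 0, is diagonalizable and has exactly two fixed
points. Klein's count of the orbits with nontrivial stabilizer then yields a point whose stabilizer
has index at most 12 (`MulAction.exists_index_stabilizer_le_twelve`). Point stabilizers are abelian,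
even after lifting to `GL₂`: a commutator of two elements with a common eigenvector is unipotent, so
it is trivial once it has finite order (`commute_of_smul_eq`).

Lower bound: a nontrivial element of `𝔄₅` has at most 5 elements in its centralizer, so abelian
subgroups have index at least 60/5 = 12. Indices do not increase under surjections, so the bound
passes to every finite group mapping onto `𝔄₅`.

Existence: an explicit binary icosahedral group, checked by finite computation over `ℤ[φ, ω]`,
embeds in `GL₂(k)`, and its image in `PGL(2, k)` is `𝔄₅`. -/

/-! ### Klein's orbit count -/

theorem le_twelve_of_mul_two_eq {N a b c f g : ℕ} (ha : a * 2 = N) (hb : b * f = N)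
    (hc : c * g = N) (hf : 2 ≤ f) (hg : 2 ≤ g) (h : a + b + c = N + 2) :
    a ≤ 12 ∨ b ≤ 12 ∨ c ≤ 12 := by
  by_contra! hlt
  obtain ⟨h1, h2, h3⟩ := hlt
  have key : ∀ {b c f g : ℕ}, b * f = N → c * g = N → 2 ≤ f → f ≤ 3 → 12 < c →
      a + b + c = N + 2 → False := by
    intro b c f g hb hc hf2 hf3 hc12 h
    interval_cases f
    · omega
    -- From 2a = 3b = N follows 6c = N + 12, so c(6 - g) = 12, which forces c ≤ 12.
    · have h6 : c * g + 12 = c * 6 := by omega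
      have hlt : g < 6 := by
        by_contra! hle
        have := Nat.mul_le_mul_left c hle
        omega
      have : c * (g + 1) ≤ c * 6 := Nat.mul_le_mul_left c hlt
      rw [mul_add] at this
      omega
  by_cases hf3 : f ≤ 3
  · exact key hb hc hf hf3 h3 h
  by_cases hg3 : g ≤ 3
  · exact key hc hb hg hg3 h2 (by omega)
  have h4 := Nat.mul_le_mul_left b (show 4 ≤ f by omega)
  have h5 := Nat.mul_le_mul_left c (show 4 ≤ g by omega)
  omega

/-- Dividing by N gives 1/e + 1/f + 1/g = 1 + 2/N > 1, so e, f, g cannot all be at least 3. -/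
theorem le_twelve_of_add_add_eq {N a b c e f g : ℕ} (ha : a * e = N) (hb : b * f = N)
    (hc : c * g = N) (he : 2 ≤ e) (hf : 2 ≤ f) (hg : 2 ≤ g) (h : a + b + c = N + 2) :
    a ≤ 12 ∨ b ≤ 12 ∨ c ≤ 12 := by
  by_cases he2 : e = 2
  · subst he2
    exact le_twelve_of_mul_two_eq ha hb hc hf hg h
  by_cases hf2 : f = 2
  · subst hf2
    have := le_twelve_of_mul_two_eq hb ha hc he hg (by omega)
    tauto
  by_cases hg2 : g = 2
  · subst hg2
    have := le_twelve_of_mul_two_eq hc ha hb he hf (by omega)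
    tauto
  have h3 := Nat.mul_le_mul_left a (show 3 ≤ e by omega)
  have h4 := Nat.mul_le_mul_left b (show 3 ≤ f by omega)
  have h5 := Nat.mul_le_mul_left c (show 3 ≤ g by omega)
  omega

/-- The numerical part of Klein's orbit count: if the orbit sizes `n i` and the stabilizer orders
`e i ≥ 2` satisfy the class formula, then some orbit has at most twelve elements. -/
theorem exists_le_twelve_of_sum_add {ι : Type*} [Fintype ι] {N : ℕ} (hN : 2 ≤ N) (n e : ι → ℕ)
    (hne : ∀ i, n i * e i = N) (he : ∀ i, 2 ≤ e i)
    (h : ∑ i, n i + 2 * (N - 1) = Fintype.card ι * N) : ∃ i, n i ≤ 12 := by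
  have hle : ∑ i, n i * 2 ≤ Fintype.card ι * N := by
    rw [← smul_eq_mul (Fintype.card ι), ← Finset.card_univ, ← Finset.sum_const]
    exact Finset.sum_le_sum fun i _ ↦ hne i ▸ Nat.mul_le_mul_left _ (he i)
  rw [← Finset.sum_mul] at hle
  -- Each orbit has at most N/2 points, so r orbits give rN/2 ≤ 2(N - 1) < 2N.
  have hr : Fintype.card ι < 4 := by
    by_contra! h4
    have := Nat.mul_le_mul_right N h4
    omega
  obtain ⟨r, ε⟩ : ∃ r, Nonempty (ι ≃ Fin r) := ⟨_, ⟨Fintype.equivFin ι⟩⟩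
  obtain ⟨ε⟩ := ε
  have hcard : Fintype.card ι = r := by simpa using Fintype.card_congr ε
  rw [hcard] at h hr
  rw [← ε.symm.sum_comp] at h
  interval_cases r
  · simp at h; omega
  · have := hne (ε.symm 0)
    refine ⟨ε.symm 0, ?_⟩
    simp at h; omega
  · refine ⟨ε.symm 0, ?_⟩
    simp [Fin.sum_univ_two] at h; omega
  · rw [Fin.sum_univ_three] at h
    rcases le_twelve_of_add_add_eq (hne (ε.symm 0)) (hne (ε.symm 1)) (hne (ε.symm 2)) (he _) (he _)
      (he _) (by omega) with h | h | h
    exacts [⟨_, h⟩, ⟨_, h⟩, ⟨_, h⟩]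

/-- If every nontrivial element of a finite group has exactly two fixed points, then some point
has a stabilizer of index at most twelve. -/
theorem MulAction.exists_index_stabilizer_le_twelve {G X : Type*} [Group G] [Finite G]
    [MulAction G X] [Nonempty X] (h : ∀ g : G, g ≠ 1 → Nat.card (fixedBy X g) = 2) :
    ∃ x : X, (stabilizer G x).index ≤ 12 := by
  classical
  rcases subsingleton_or_nontrivial G with hG | hG
  · refine ⟨Classical.arbitrary X, ?_⟩
    rw [Subsingleton.elim (stabilizer G (Classical.arbitrary X)) ⊤]
    simp
  have := Fintype.ofFinite G
  -- `X` may be infinite; the points with nontrivial stabilizer form a finite invariant set, to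
  -- which Burnside's formula applies.
  let Y : SubMulAction G X :=
    { carrier := {x | stabilizer G x ≠ ⊥}
      smul_mem' := fun g x hx hbot ↦ hx <| by
        rw [stabilizer_smul_eq_stabilizer_map_conj] at hbot
        exact (Subgroup.map_eq_bot_iff_of_injective _ (MulAut.conj g).injective).1 hbot }
  have memY {x : X} : x ∈ Y ↔ ∃ g : G, g ≠ 1 ∧ g • x = x := by
    change stabilizer G x ≠ ⊥ ↔ _
    rw [Ne, Subgroup.eq_bot_iff_forall]
    push Not
    simp only [mem_stabilizer_iff]
    tauto
  have hfin (g : G) (hg : g ≠ 1) : (fixedBy X g).Finite :=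
    Nat.finite_of_card_ne_zero (by rw [h g hg]; norm_num)
  have hYfin : Finite Y := by
    refine Set.Finite.subset (s := ⋃ g : {g : G // g ≠ 1}, fixedBy X g.1)
      (Set.finite_iUnion fun g ↦ hfin g.1 g.2) fun x hx ↦ ?_
    obtain ⟨g, hg, hgx⟩ := memY.1 hx
    exact Set.mem_iUnion.2 ⟨⟨g, hg⟩, hgx⟩
  have := Fintype.ofFinite Y
  have hfix (g : G) (hg : g ≠ 1) : Fintype.card (fixedBy Y g) = 2 := by
    rw [← Nat.card_eq_fintype_card, ← h g hg]
    refine Nat.card_congr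
      { toFun := fun y ↦ ⟨y.1.1, congrArg Subtype.val y.2⟩
        invFun := fun x ↦ ⟨⟨x.1, memY.2 ⟨g, hg, x.2⟩⟩, Subtype.ext x.2⟩
        left_inv := fun _ ↦ rfl
        right_inv := fun _ ↦ rfl }
  have := Fintype.ofFinite (Quotient (orbitRel G Y))
  have burnside := sum_card_fixedBy_eq_card_orbits_mul_card_group G Y
  have hone : Fintype.card (fixedBy Y (1 : G)) = Fintype.card Y := by simp
  rw [← Finset.add_sum_erase _ _ (Finset.mem_univ (1 : G)), hone,
    Finset.sum_congr rfl (fun g hg ↦ hfix g (Finset.ne_of_mem_erase hg)), Finset.sum_const,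
    Finset.card_erase_of_mem (Finset.mem_univ _), Finset.card_univ, smul_eq_mul, mul_comm _ 2,
    Fintype.card_congr (selfEquivSigmaOrbits G Y), Fintype.card_sigma] at burnside
  obtain ⟨i, hi⟩ := exists_le_twelve_of_sum_add (Fintype.one_lt_card (α := G)) _
    (fun ω : Quotient (orbitRel G Y) ↦ Fintype.card (stabilizer G ω.out))
    (fun ω ↦ card_orbit_mul_card_stabilizer_eq_card_group G ω.out)
    (fun ω ↦ by
      have hω : stabilizer G (ω.out : X) ≠ ⊥ := ω.out.2
      have : 1 < Nat.card (stabilizer G ω.out) := by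
        rw [Subgroup.one_lt_card_iff_ne_bot]
        convert hω using 1
        ext g
        simp [Subtype.ext_iff]
      rwa [Nat.card_eq_fintype_card] at this) burnside
  refine ⟨i.out.1, ?_⟩
  have : stabilizer G i.out.1 = stabilizer G i.out := by
    ext g
    simp [Subtype.ext_iff]
  rwa [this, index_stabilizer, ← Nat.card_coe_set_eq, Nat.card_eq_fintype_card]

/-! ### Fixed points and stabilizers on the projective line -/

section

open Matrix Matrix.GeneralLinearGroup LinearAlgebra.Projectivization
open scoped commutatorElement

variable {k : Type*} [Field k]

theorem Matrix.det_sub_one_fin_two (A : Matrix (Fin 2) (Fin 2) k) :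
    (A - 1).det = A.det - A.trace + 1 := by
  simp [det_fin_two, trace_fin_two]
  ring

/-- A nonscalar matrix with zero discriminant is parabolic, and in characteristic 0 its nonzero
powers stay parabolic, hence nonscalar. -/
theorem Matrix.GeneralLinearGroup.discr_ne_zero_of_isOfFinOrder [CharZero k] {M : GL (Fin 2) k}
    (h : IsOfFinOrder (ProjGenLinGroup.mk M)) (h1 : ProjGenLinGroup.mk M ≠ 1) :
    M.val.discr ≠ 0 := by
  intro hd
  obtain ⟨n, hn, hpow⟩ := isOfFinOrder_iff_pow_eq_one.1 h
  rw [Ne, ProjGenLinGroup.mk_eq_one, mem_center_iff_val_mem_range_scalar] at h1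
  rw [← map_pow, ProjGenLinGroup.mk_eq_one, mem_center_iff_val_mem_range_scalar] at hpow
  exact (IsParabolic.pow (g := M) ⟨h1, hd⟩ hn.ne').1 hpow

/-- Over an algebraically closed field, a Möbius transformation with nonzero discriminant has
exactly two fixed points. -/
theorem Matrix.GeneralLinearGroup.exists_smul_eq_self_iff [IsAlgClosed k] [DecidableEq k]
    {M : GL (Fin 2) k} (h : M.val.discr ≠ 0) (h2 : (2 : k) ≠ 0) :
    ∃ p q : OnePoint k, p ≠ q ∧ ∀ x, M • x = x ↔ x = p ∨ x = q := by
  rw [discr_fin_two, trace_fin_two, det_fin_two] at h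
  have hcoe (z : k) : M • (z : OnePoint k) = z ↔
      M 1 0 * z ^ 2 + (M 1 1 - M 0 0) * z - M 0 1 = 0 := by
    rw [← fixpointPolynomial_aeval_eq_zero_iff]
    simp [fixpointPolynomial]
  by_cases hc : M 1 0 = 0
  · have had : M 1 1 - M 0 0 ≠ 0 := by
      intro had
      apply h
      rw [hc]
      linear_combination (M 1 1 - M 0 0) * had
    refine ⟨OnePoint.infty, ((M 0 1 / (M 1 1 - M 0 0) : k) : OnePoint k),
      OnePoint.infty_ne_coe _, fun x ↦ ?_⟩
    cases x with
    | infty => simp [OnePoint.smul_infty_eq_self_iff, hc]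
    | coe z =>
      rw [hcoe, hc, OnePoint.coe_eq_coe, eq_div_iff had]
      simp only [OnePoint.coe_ne_infty, false_or]
      constructor <;> intro hz <;> linear_combination hz
  · obtain ⟨s, hs⟩ := IsAlgClosed.exists_pow_nat_eq
      ((M 0 0 + M 1 1) ^ 2 - 4 * (M 0 0 * M 1 1 - M 0 1 * M 1 0)) two_pos
    have hs0 : s ≠ 0 := by
      rintro rfl
      exact h (by rw [← hs]; simp)
    refine ⟨(((M 0 0 - M 1 1 + s) / (2 * M 1 0) : k) : OnePoint k),
      (((M 0 0 - M 1 1 - s) / (2 * M 1 0) : k) : OnePoint k), ?_, fun x ↦ ?_⟩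
    · rw [Ne, OnePoint.coe_eq_coe, div_left_inj' (mul_ne_zero h2 hc)]
      intro he
      have : 2 * s = 0 := by linear_combination he
      simp_all
    · cases x with
      | infty => simp [OnePoint.smul_infty_eq_self_iff, hc]
      | coe z =>
        rw [hcoe, OnePoint.coe_eq_coe, OnePoint.coe_eq_coe, eq_div_iff (mul_ne_zero h2 hc),
          eq_div_iff (mul_ne_zero h2 hc), ← sub_eq_zero (b := M 0 0 - M 1 1 + s),
          ← sub_eq_zero (b := M 0 0 - M 1 1 - s),
          ← mul_eq_zero]
        constructor
        · intro hz
          linear_combination 4 * M 1 0 * hz - hs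
        · intro hz
          have : 4 * M 1 0 * (M 1 0 * z ^ 2 + (M 1 1 - M 0 0) * z - M 0 1) = 0 := by
            linear_combination hz + hs
          rcases mul_eq_zero.1 this with h4 | h4
          · refine absurd h4 (mul_ne_zero ?_ hc)
            rw [show (4 : k) = 2 * 2 by norm_num]
            exact mul_ne_zero h2 h2
          · exact h4

theorem Matrix.ProjGenLinGroup.card_fixedBy_eq_two [IsAlgClosed k] [CharZero k] {g : PGL(2, k)}
    (h : IsOfFinOrder g) (h1 : g ≠ 1) :
    Nat.card (MulAction.fixedBy (ℙ k (Fin 2 → k)) g) = 2 := by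
  classical
  obtain ⟨M, rfl⟩ := ProjGenLinGroup.mk_surjective g
  obtain ⟨p, q, hpq, hM⟩ := exists_smul_eq_self_iff (discr_ne_zero_of_isOfFinOrder h h1) two_ne_zero
  rw [Nat.card_coe_set_eq, Set.ncard_eq_two]
  refine ⟨OnePoint.equivProjectivization k p, OnePoint.equivProjectivization k q, by simpa, ?_⟩
  ext x
  obtain ⟨y, rfl⟩ := (OnePoint.equivProjectivization k).surjective x
  have : ProjGenLinGroup.mk M • OnePoint.equivProjectivization k y
    = M • OnePoint.equivProjectivization k y := rfl
  rw [MulAction.mem_fixedBy, this, ← OnePoint.equivProjectivization_smul]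
  simp [hM]

theorem Matrix.GeneralLinearGroup.exists_mulVec_eq_smul {M : GL (Fin 2) k} {v : Fin 2 → k}
    {hv : v ≠ 0} (h : ProjGenLinGroup.mk M • Projectivization.mk k v hv =
      Projectivization.mk k v hv) : ∃ a : k, M.val *ᵥ v = a • v := by
  rw [Projectivization.PGL.mk_smul_mk, Projectivization.mk_eq_mk_iff'] at h
  obtain ⟨a, ha⟩ := h
  exact ⟨a, ha.symm⟩

/-- Two matrices with a common eigenvector commute as soon as their commutator has finite order
modulo scalars. -/
theorem Matrix.GeneralLinearGroup.commute_of_smul_eq [CharZero k] {M N : GL (Fin 2) k}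
    {p : ℙ k (Fin 2 → k)} (hM : ProjGenLinGroup.mk M • p = p) (hN : ProjGenLinGroup.mk N • p = p)
    (h : IsOfFinOrder (ProjGenLinGroup.mk ⁅M, N⁆)) : Commute M N := by
  induction p using Projectivization.ind with | h v hv
  obtain ⟨a, ha⟩ := exists_mulVec_eq_smul hM
  obtain ⟨b, hb⟩ := exists_mulVec_eq_smul hN
  set C := ⁅M, N⁆ with hC
  have hMN : C * (N * M) = M * N := by rw [hC, commutatorElement_def]; group
  have hab : (N * M).val *ᵥ v = (a * b) • v := by
    rw [Units.val_mul, ← mulVec_mulVec, ha, mulVec_smul, hb, smul_smul]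
  have hba : (M * N).val *ᵥ v = (a * b) • v := by
    rw [Units.val_mul, ← mulVec_mulVec, hb, mulVec_smul, ha, smul_smul, mul_comm]
  have hab0 : a * b ≠ 0 := by
    intro h0
    rw [h0, zero_smul] at hab
    exact hv (eq_zero_of_mulVec_eq_zero (N * M).det_ne_zero hab)
  -- On the common eigenvector `M * N` and `N * M` both act by `a * b`. So `C` has eigenvalue 1 and
  -- determinant 1, which makes it unipotent with zero discriminant.
  have hCv : C.val *ᵥ v = v := by
    have : (C * (N * M)).val *ᵥ v = (M * N).val *ᵥ v := by rw [hMN]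
    rw [Units.val_mul C, ← mulVec_mulVec, hab, hba, mulVec_smul] at this
    exact smul_right_injective _ hab0 this
  have hdet : C.val.det = 1 := by
    have : det C = 1 := by rw [hC, map_commutatorElement, commutatorElement_eq_one_iff_mul_comm,
      mul_comm]
    simpa using congrArg Units.val this
  have hsub : (C.val - 1).det = 0 := by
    by_contra hne
    exact hv (eq_zero_of_mulVec_eq_zero hne (by rw [sub_mulVec, hCv, one_mulVec, sub_self]))
  have hdiscr : C.val.discr = 0 := by
    rw [det_sub_one_fin_two] at hsub
    rw [discr_fin_two, hdet]
    linear_combination (- (C.val.trace + 2)) * (hsub - hdet)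
  have hone : ProjGenLinGroup.mk C = 1 := by
    by_contra h1
    exact discr_ne_zero_of_isOfFinOrder h h1 hdiscr
  rw [ProjGenLinGroup.mk_eq_one, mem_center_iff_val_mem_range_scalar] at hone
  obtain ⟨c, hc⟩ := hone
  have hc1 : c = 1 := by
    rw [← hc] at hCv
    simp only [scalar_apply, ← smul_one_eq_diagonal, smul_mulVec, one_mulVec] at hCv
    exact smul_left_injective _ hv (by simpa using hCv)
  have hC1 : C = 1 := Units.ext (by rw [← hc, hc1]; simp)
  rwa [hC, commutatorElement_eq_one_iff_commute] at hC1

theorem Matrix.ProjGenLinGroup.exists_index_stabilizer_le_twelve [IsAlgClosed k] [CharZero k]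
    (Q : Subgroup PGL(2, k)) [Finite Q] :
    ∃ p : ℙ k (Fin 2 → k), (MulAction.stabilizer Q p).index ≤ 12 := by
  refine MulAction.exists_index_stabilizer_le_twelve fun g hg ↦ ?_
  exact card_fixedBy_eq_two (Submonoid.isOfFinOrder_coe.2 (isOfFinOrder_of_finite g))
    (fun h ↦ hg (Subtype.ext h))

theorem isWeakJordanBound_GL [IsAlgClosed k] [CharZero k] :
    IsWeakJordanBound (GL (Fin 2) k) 12 := by
  intro G hG
  have : Finite (G.map (ProjGenLinGroup.mk (n := Fin 2) (R := k))) :=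
    Finite.of_surjective _ (ProjGenLinGroup.mk.subgroupMap_surjective G)
  obtain ⟨p, hp⟩ := ProjGenLinGroup.exists_index_stabilizer_le_twelve (G.map ProjGenLinGroup.mk)
  refine ⟨(MulAction.stabilizer _ p).comap (ProjGenLinGroup.mk.subgroupMap G), ⟨⟨?_⟩⟩, ?_⟩
  · rintro ⟨⟨M, hM⟩, hMp⟩ ⟨⟨N, hN⟩, hNp⟩
    refine Subtype.ext (Subtype.ext ?_)
    have hMp' : ProjGenLinGroup.mk M • p = p := hMp
    have hNp' : ProjGenLinGroup.mk N • p = p := hNp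
    have hc := MonoidHom.isOfFinOrder G.subtype (isOfFinOrder_of_finite ⁅(⟨M, hM⟩ : G), ⟨N, hN⟩⁆)
    rw [map_commutatorElement] at hc
    exact commute_of_smul_eq hMp' hNp' (MonoidHom.isOfFinOrder ProjGenLinGroup.mk hc)
  · rwa [Subgroup.index_comap_of_surjective _ (ProjGenLinGroup.mk.subgroupMap_surjective G)]

theorem isWeakJordanBound_PGL [IsAlgClosed k] [CharZero k] :
    IsWeakJordanBound PGL(2, k) 12 := by
  intro Q hQ
  obtain ⟨p, hp⟩ := ProjGenLinGroup.exists_index_stabilizer_le_twelve Q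
  refine ⟨MulAction.stabilizer Q p, ⟨⟨?_⟩⟩, hp⟩
  rintro ⟨⟨x, hx⟩, hxp⟩ ⟨⟨y, hy⟩, hyp⟩
  refine Subtype.ext (Subtype.ext ?_)
  have hc : IsOfFinOrder ⁅x, y⁆ :=
    Submonoid.isOfFinOrder_coe.2 (isOfFinOrder_of_finite ⁅(⟨x, hx⟩ : Q), (⟨y, hy⟩ : Q)⁆)
  obtain ⟨M, rfl⟩ := ProjGenLinGroup.mk_surjective x
  obtain ⟨N, rfl⟩ := ProjGenLinGroup.mk_surjective y
  rw [← map_commutatorElement] at hc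
  exact (commute_of_smul_eq (p := p) hxp hyp hc).map ProjGenLinGroup.mk

end

/-- The normal core of `A` is the kernel of the action on the cosets of `A`, so its index divides
the factorial of the index of `A`. -/
theorem IsWeakJordanBound.isJordanGroup {Γ : Type*} [Group Γ] {J : ℕ}
    (h : IsWeakJordanBound Γ J) : IsJordanGroup Γ := by
  refine ⟨J.factorial, fun G hG ↦ ?_⟩
  obtain ⟨A, hA, hAJ⟩ := h G hG
  refine ⟨A.normalCore, A.normalCore_normal, ⟨⟨fun x y ↦ Subtype.ext ?_⟩⟩, ?_⟩
  · exact congrArg (Subtype.val : A → G)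
      (hA.is_comm.comm (⟨x, A.normalCore_le x.2⟩ : A) ⟨y, A.normalCore_le y.2⟩)
  · have hdvd : A.normalCore.index ∣ A.index.factorial := by
      rw [A.normalCore_eq_ker, Subgroup.index_ker, Subgroup.index_eq_card, ← Nat.card_perm]
      exact Subgroup.card_subgroup_dvd_card _
    exact (Nat.le_of_dvd (Nat.factorial_pos _) hdvd).trans (Nat.factorial_le hAJ)

/-! ### The binary icosahedral group -/

namespace BinaryIcosahedral

open Matrix QuadraticAlgebra

/-- The ring `ℤ[φ, ω]`, where `φ ^ 2 = φ + 1` and `ω ^ 2 = -1 - ω`. -/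
abbrev Coeff : Type := QuadraticAlgebra (QuadraticAlgebra ℤ 1 1) (-1) (-1)

/-- A generator of order four, paired with an involution of `𝔄₅`. -/
def s : alternatingGroup (Fin 5) × SL(2, Coeff) :=
  (⟨Equiv.swap 1 2 * Equiv.swap 3 4, Equiv.Perm.mem_alternatingGroup.2 (by decide)⟩, ⟨!![0, 1 + ω; ω, 0], by decide⟩)

/-- A generator of order ten, paired with a five-cycle. -/
def t : alternatingGroup (Fin 5) × SL(2, Coeff) :=
  (⟨finRotate 5, Equiv.Perm.mem_alternatingGroup.2 (by decide)⟩, ⟨!![0, -1; 1, QuadraticAlgebra.C ω], by decide⟩)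

/-- Representatives of the left cosets of `⟨t⟩` in `⟨s, t⟩`. -/
def cosetReps : List (alternatingGroup (Fin 5) × SL(2, Coeff)) :=
  [1, s, t * s, t ^ 2 * s, t ^ 3 * s, t ^ 4 * s, s * t ^ 2 * s, t * s * t ^ 2 * s,
    t ^ 2 * s * t ^ 2 * s, t ^ 3 * s * t ^ 2 * s, t ^ 4 * s * t ^ 2 * s,
    s * t ^ 2 * s * t ^ 3 * s]

theorem t_pow_ten : t ^ 10 = 1 := by decide +kernel

theorem s_pow_four : s ^ 4 = 1 := by decide +kernel

theorem s_sq : s ^ 2 = (1, -1) := by decide +kernel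

theorem s_sq_ne_one : s ^ 2 ≠ 1 := by decide +kernel

theorem exists_s_mul_eq : ∀ w ∈ cosetReps, ∃ w' ∈ cosetReps, ∃ j ∈ List.range 10,
    s * w = w' * t ^ j := by
  decide +kernel

theorem exists_t_mul_eq : ∀ w ∈ cosetReps, ∃ w' ∈ cosetReps, ∃ j ∈ List.range 10,
    t * w = w' * t ^ j := by
  decide +kernel

theorem eq_of_fst_eq_one : ∀ w ∈ cosetReps, ∀ j ∈ List.range 10, (w * t ^ j).1 = 1 →
    w * t ^ j = 1 ∨ w * t ^ j = s ^ 2 := by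
  decide +kernel

theorem eq_of_sq_eq_one : ∀ w ∈ cosetReps, ∀ j ∈ List.range 10, (w * t ^ j) ^ 2 = 1 →
    w * t ^ j = 1 ∨ w * t ^ j = s ^ 2 := by
  decide +kernel

/-- Exponents below 5 suffice, since the first component of `t` is a five-cycle. -/
theorem exists_fst_eq : ∀ g : alternatingGroup (Fin 5), ∃ w ∈ cosetReps, ∃ j ∈ List.range 5,
    (w * t ^ j).1 = g := by
  decide +kernel

/-- The binary icosahedral group, as a subgroup of `𝔄₅ × SL₂(ℤ[φ, ω])`. -/
def group : Subgroup (alternatingGroup (Fin 5) × SL(2, Coeff)) :=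
  Subgroup.closure {s, t}

theorem s_mem : s ∈ group := Subgroup.subset_closure (by simp)

theorem t_mem : t ∈ group := Subgroup.subset_closure (by simp)

theorem cosetReps_subset {w : alternatingGroup (Fin 5) × SL(2, Coeff)} (hw : w ∈ cosetReps) :
    w ∈ group := by
  have hs := s_mem
  have ht := t_mem
  simp only [cosetReps, List.mem_cons, List.not_mem_nil, or_false] at hw
  generalize group = H at *
  generalize s = a at *
  generalize t = b at *
  have hb (n : ℕ) : b ^ n ∈ H := pow_mem ht n
  rcases hw with rfl | rfl | rfl | rfl | rfl | rfl | rfl | rfl | rfl | rfl | rfl | rfl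
  all_goals
    repeat' first
      | exact one_mem _
      | exact hs
      | exact ht
      | exact hb _
      | apply mul_mem

/-- The products `w * t ^ j` include 1 and are stable under left multiplication by the generators.
Statements about all of `group` thus become finite checks. -/
theorem exists_eq_mul_pow {x : alternatingGroup (Fin 5) × SL(2, Coeff)} (hx : x ∈ group) :
    ∃ w ∈ cosetReps, ∃ j ∈ List.range 10, x = w * t ^ j := by
  let P (x : alternatingGroup (Fin 5) × SL(2, Coeff)) : Prop :=
    ∃ w ∈ cosetReps, ∃ j ∈ List.range 10, x = w * t ^ j
  have aux {g x} (hg : ∀ w ∈ cosetReps, P (g * w)) : P x → P (g * x) := by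
    rintro ⟨w, hw, j, -, rfl⟩
    obtain ⟨w', hw', i, -, hi⟩ := hg w hw
    refine ⟨w', hw', (i + j) % 10, List.mem_range.2 (Nat.mod_lt _ (by norm_num)), ?_⟩
    rw [← mul_assoc, hi, mul_assoc, ← pow_add, ← pow_eq_pow_mod _ t_pow_ten]
  have hs {x} : P x → P (s * x) := aux exists_s_mul_eq
  have ht {x} : P x → P (t * x) := aux exists_t_mul_eq
  have pow {g : alternatingGroup (Fin 5) × SL(2, Coeff)} (hg : ∀ {x}, P x → P (g * x)) (n : ℕ) {x}
      (hx : P x) : P (g ^ n * x) := by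
    induction n with
    | zero => simpa
    | succ n ih => rw [pow_succ', mul_assoc]; exact hg ih
  -- Inverses of the generators are positive powers, so stability under `s` and `t` is enough.
  have hs' : s⁻¹ = s ^ 3 := inv_eq_of_mul_eq_one_right (by rw [← pow_succ', s_pow_four])
  have ht' : t⁻¹ = t ^ 9 := inv_eq_of_mul_eq_one_right (by rw [← pow_succ', t_pow_ten])
  induction hx using Subgroup.closure_induction_left with
  | one => exact ⟨1, by simp [cosetReps], 0, by simp, by simp⟩
  | mul_left g hg y _ ih =>
    obtain rfl | rfl := hg
    exacts [hs ih, ht ih]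
  | inv_mul_cancel g hg y _ ih =>
    obtain rfl | rfl := hg
    exacts [hs' ▸ pow hs 3 ih, ht' ▸ pow ht 9 ih]

theorem eq_one_or_eq_of_fst {x : alternatingGroup (Fin 5) × SL(2, Coeff)} (hx : x ∈ group)
    (h : x.1 = 1) : x = 1 ∨ x = (1, -1) := by
  obtain ⟨w, hw, j, hj, rfl⟩ := exists_eq_mul_pow hx
  exact s_sq ▸ eq_of_fst_eq_one w hw j hj h

theorem eq_one_or_eq_of_sq {x : alternatingGroup (Fin 5) × SL(2, Coeff)} (hx : x ∈ group)
    (h : x ^ 2 = 1) : x = 1 ∨ x = (1, -1) := by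
  obtain ⟨w, hw, j, hj, rfl⟩ := exists_eq_mul_pow hx
  exact s_sq ▸ eq_of_sq_eq_one w hw j hj h

/-- The nontrivial central element. -/
def z : group := ⟨(1, -1), s_sq ▸ pow_mem s_mem 2⟩

theorem z_ne_one : z ≠ 1 := fun h ↦ s_sq_ne_one (s_sq.trans (congrArg Subtype.val h))

theorem z_mem_center : z ∈ Subgroup.center group :=
  Subgroup.mem_center_iff.2 fun x ↦ Subtype.ext (by ext <;> simp [z])

/-- The projection of the binary icosahedral group onto `𝔄₅`. -/
def toAlternating : group →* alternatingGroup (Fin 5) := (MonoidHom.fst _ _).comp group.subtype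

theorem toAlternating_surjective : Function.Surjective toAlternating := fun g ↦ by
  obtain ⟨w, hw, j, -, h⟩ := exists_fst_eq g
  exact ⟨⟨w * t ^ j, mul_mem (cosetReps_subset hw) (pow_mem t_mem j)⟩, h⟩

theorem mem_ker_toAlternating {x : group} : x ∈ toAlternating.ker ↔ x = 1 ∨ x = z := by
  refine ⟨fun h ↦ ?_, ?_⟩
  · exact (eq_one_or_eq_of_fst x.2 h).imp Subtype.ext Subtype.ext
  · rintro (rfl | rfl)
    exacts [one_mem _, rfl]

theorem isCentralExtension : IsCentralExtensionByCyclic 2 group (alternatingGroup (Fin 5)) := by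
  have hcard : Nat.card toAlternating.ker = 2 := by
    have : (toAlternating.ker : Set group) = {1, z} := by
      ext x
      simpa using mem_ker_toAlternating
    rw [← SetLike.coe_sort_coe, this, Nat.card_coe_set_eq, Set.ncard_pair z_ne_one.symm]
  refine ⟨toAlternating, toAlternating_surjective, fun x hx ↦ ?_, ?_, hcard⟩
  · obtain rfl | rfl := mem_ker_toAlternating.1 hx
    exacts [one_mem _, z_mem_center]
  · have : Fact (Nat.Prime 2) := ⟨Nat.prime_two⟩
    exact isCyclic_of_prime_card hcard

/-- The element `z` is the only involution of `group`, whereas the direct product has an involution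
in each factor. -/
theorem not_nonempty_mulEquiv_prod :
    ¬ Nonempty (group ≃* alternatingGroup (Fin 5) × Multiplicative (ZMod 2)) := by
  rintro ⟨e⟩
  have key (y : alternatingGroup (Fin 5) × Multiplicative (ZMod 2)) (hy : y ^ 2 = 1)
      (hy1 : y ≠ 1) : e.symm y = z := by
    have h2 : (e.symm y) ^ 2 = 1 := by rw [← map_pow, hy, map_one]
    refine ((eq_one_or_eq_of_sq (e.symm y).2 (congrArg Subtype.val h2)).resolve_left
      fun h ↦ hy1 ?_) |> Subtype.ext
    exact e.symm.injective ((Subtype.ext h).trans (map_one _).symm)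
  have h1 := key (1, Multiplicative.ofAdd 1) (by decide) (by decide)
  have h2 := key (s.1, 1) (by decide +kernel) (by decide +kernel)
  have := congrArg Prod.snd (e.symm.injective (h1.trans h2.symm))
  revert this
  decide

/-! ### Embedding into `GL₂(k)` -/

section Representation

variable {k : Type*} [Field k]

/-- The representation of the binary icosahedral group given by a specialization of `φ`
and `ω`. -/
def toGL (f : Coeff →+* k) : group →* GL (Fin 2) k :=
  (SpecialLinearGroup.toGL.comp (SpecialLinearGroup.map f)).comp
    ((MonoidHom.snd _ _).comp group.subtype)

theorem toGL_z (f : Coeff →+* k) : toGL f z = -1 := by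
  ext i j
  fin_cases i <;> fin_cases j <;> simp [toGL, z]

theorem ker_mk_comp_toGL (f : Coeff →+* k) :
    (ProjGenLinGroup.mk.comp (toGL f)).ker = toAlternating.ker := by
  set ρ := ProjGenLinGroup.mk.comp (toGL f) with hρ
  have hle : toAlternating.ker ≤ ρ.ker := by
    intro x hx
    obtain rfl | rfl := mem_ker_toAlternating.1 hx
    · exact one_mem _
    · rw [MonoidHom.mem_ker, hρ, MonoidHom.comp_apply, toGL_z, ProjGenLinGroup.mk_eq_one,
        Subgroup.mem_center_iff]
      intro g
      simp
  refine le_antisymm ?_ hle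
  -- By simplicity of `𝔄₅` this image is trivial or everything. In the latter case `t` would act as
  -- a scalar, but its lower left entry is 1.
  have hnormal : (ρ.ker.map toAlternating).Normal :=
    Subgroup.Normal.map inferInstance _ toAlternating_surjective
  rcases hnormal.eq_bot_or_eq_top with h | h
  · rwa [Subgroup.map_eq_bot_iff] at h
  · have htop : ρ.ker = ⊤ := by
      have := congrArg (Subgroup.comap toAlternating) h
      rwa [Subgroup.comap_map_eq, Subgroup.comap_top, sup_of_le_left hle] at this
    have ht : (⟨t, t_mem⟩ : group) ∈ ρ.ker := htop ▸ Subgroup.mem_top _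
    rw [MonoidHom.mem_ker, hρ, MonoidHom.comp_apply, ProjGenLinGroup.mk_eq_one,
      GeneralLinearGroup.mem_center_iff_val_mem_range_scalar] at ht
    obtain ⟨a, ha⟩ := ht
    have := congrFun (congrFun ha 1) 0
    have hent : (toGL f ⟨t, t_mem⟩).val 1 0 = f 1 := rfl
    rw [hent, map_one] at this
    simp at this

theorem toGL_injective [CharZero k] (f : Coeff →+* k) : Function.Injective (toGL f) := by
  rw [injective_iff_map_eq_one]
  intro x hx
  have : x ∈ toAlternating.ker := by
    rw [← ker_mk_comp_toGL f, MonoidHom.mem_ker, MonoidHom.comp_apply, hx, map_one]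
  refine (mem_ker_toAlternating.1 this).resolve_right ?_
  rintro rfl
  rw [toGL_z] at hx
  have := congrArg (fun g : GL (Fin 2) k ↦ g 0 0) hx
  simp at this
  have h2 : (2 : k) = 0 := by linear_combination -this
  exact two_ne_zero h2

theorem nonempty_coeff_ringHom [IsAlgClosed k] : Nonempty (Coeff →+* k) := by
  have root (a b : k) : ∃ u : k, u * u = a + b * u := by
    have hdeg : (Polynomial.X ^ 2 - Polynomial.C b * Polynomial.X
        - Polynomial.C a : Polynomial k).degree = 2 := by compute_degree!
    obtain ⟨u, hu⟩ := IsAlgClosed.exists_root _ (by rw [hdeg]; norm_num)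
    refine ⟨u, ?_⟩
    simp at hu
    linear_combination hu
  obtain ⟨u, hu⟩ := root 1 1
  let g : QuadraticAlgebra ℤ 1 1 →ₐ[ℤ] k := QuadraticAlgebra.lift ⟨u, by simpa using hu⟩
  let _ : Algebra (QuadraticAlgebra ℤ 1 1) k := g.toRingHom.toAlgebra
  obtain ⟨v, hv⟩ := root (-1) (-1)
  exact ⟨(QuadraticAlgebra.lift (R := QuadraticAlgebra ℤ 1 1) (a := -1) (b := -1)
    ⟨v, by simpa using hv⟩).toRingHom⟩

end Representation

end BinaryIcosahedral

/-! ### Lower bound from `𝔄₅`, and conclusion -/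

theorem alternatingGroup_five_card_centralizer_le : ∀ g : alternatingGroup (Fin 5), g ≠ 1 →
    (Finset.univ.filter fun h : alternatingGroup (Fin 5) ↦ g * h = h * g).card ≤ 5 := by
  decide +kernel

theorem card_alternatingGroup_five : Nat.card (alternatingGroup (Fin 5)) = 60 := by
  rw [nat_card_alternatingGroup, Nat.card_fin]
  rfl

/-- Abelian subgroups of `𝔄₅` have index at least twelve. -/
theorem twelve_le_index_of_isMulCommutative (A : Subgroup (alternatingGroup (Fin 5)))
    [hA : IsMulCommutative A] : 12 ≤ A.index := by
  classical
  have hcard : Nat.card A ≤ 5 := by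
    rcases A.bot_or_exists_ne_one with rfl | ⟨g, hg, hg1⟩
    · simp
    -- An abelian subgroup lies in the centralizer of any of its elements.
    · refine le_trans ?_ (alternatingGroup_five_card_centralizer_le g hg1)
      rw [← SetLike.coe_sort_coe, Nat.card_coe_set_eq, ← Set.ncard_coe_finset]
      refine Set.ncard_le_ncard (fun h hh ↦ ?_) (Finset.finite_toSet _)
      simpa using congrArg (Subtype.val : A → _) (hA.is_comm.comm (⟨g, hg⟩ : A) ⟨h, hh⟩)
  have := A.card_mul_index
  rw [card_alternatingGroup_five] at this
  by_contra! hlt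
  have := Nat.mul_le_mul hcard (Nat.le_of_lt_succ hlt)
  omega

/-- A finite group surjecting onto `𝔄₅` has no abelian subgroup of index less than twelve. -/
theorem twelve_le_index_of_surjective {G : Type*} [Group G] {φ : G →* alternatingGroup (Fin 5)}
    (hφ : Function.Surjective φ) (A : Subgroup G) [hA : IsMulCommutative A] [A.FiniteIndex] :
    12 ≤ A.index := by
  have : IsMulCommutative (A.map φ) := inferInstance
  exact (twelve_le_index_of_isMulCommutative (A.map φ)).trans
    (Nat.le_of_dvd (Nat.pos_of_ne_zero Subgroup.FiniteIndex.index_ne_zero)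
      (A.index_map_dvd hφ))

theorem IsWeakJordanBound.isMinAbelianIndex {Γ : Type*} [Group Γ] (h : IsWeakJordanBound Γ 12)
    {G : Subgroup Γ} [Finite G] {φ : G →* alternatingGroup (Fin 5)}
    (hφ : Function.Surjective φ) : IsMinAbelianIndex G 12 := by
  constructor
  · obtain ⟨A, hA, hA12⟩ := h G inferInstance
    exact ⟨A, hA, inferInstance, hA12.antisymm (twelve_le_index_of_surjective hφ A)⟩
  · rintro n ⟨A, hA, _, rfl⟩
    exact twelve_le_index_of_surjective hφ A

theorem IsWeakJordanBound.isWeakJordanConstant {Γ : Type*} [Group Γ] (h : IsWeakJordanBound Γ 12)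
    {G : Subgroup Γ} [hG : Finite G] {φ : G →* alternatingGroup (Fin 5)}
    (hφ : Function.Surjective φ) : IsWeakJordanConstant Γ 12 := by
  refine ⟨h.isJordanGroup, h, fun n hn ↦ ?_⟩
  obtain ⟨A, hA, hAn⟩ := hn G hG
  exact (twelve_le_index_of_surjective hφ A).trans hAn

theorem IsCentralExtensionByCyclic.finite {m : ℕ} {E Γ : Type*} [Group E] [Group Γ] [Finite Γ]
    (h : IsCentralExtensionByCyclic m E Γ) (hm : m ≠ 0) : Finite E := by
  obtain ⟨φ, -, -, -, hcard⟩ := h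
  refine Nat.finite_of_card_ne_zero ?_
  rw [← φ.ker.card_mul_index, hcard, Subgroup.index_ker]
  exact mul_ne_zero hm Nat.card_pos.ne'

theorem IsCentralExtensionByCyclic.of_mulEquiv {m : ℕ} {E E' Γ : Type*} [Group E] [Group E']
    [Group Γ] (h : IsCentralExtensionByCyclic m E Γ) (e : E' ≃* E) :
    IsCentralExtensionByCyclic m E' Γ := by
  obtain ⟨φ, hφ, hcent, hcyc, hcard⟩ := h
  let ek : (φ.comp e.toMonoidHom).ker ≃* φ.ker :=
    (e.subgroupMap _).trans (MulEquiv.subgroupCongr (by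
      rw [← MonoidHom.comap_ker]
      exact Subgroup.map_comap_eq_self_of_surjective (f := e.toMonoidHom) e.surjective φ.ker))
  refine ⟨φ.comp e.toMonoidHom, hφ.comp e.surjective, fun x hx ↦ ?_,
    isCyclic_of_surjective ek.symm ek.symm.surjective, ?_⟩
  · rw [Subgroup.mem_center_iff]
    intro g
    apply e.injective
    simpa using Subgroup.mem_center_iff.1 (hcent (show e x ∈ φ.ker from hx)) (e g)
  · rw [← hcard]
    exact Nat.card_congr ek.toEquiv

theorem corollary2p5 (k : Type*) [Field k] [IsAlgClosed k] [CharZero k] :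
    -- the weak Jordan constants
    IsWeakJordanConstant (GL (Fin 2) k) 12 ∧
    IsWeakJordanConstant PGL(2, k) 12 ∧
    -- `GL₂(k)` contains a (nontrivial) `2.A₅`, and every `2.A₅` in it attains the constant
    (∃ G : Subgroup (GL (Fin 2) k),
      IsCentralExtensionByCyclic 2 G (alternatingGroup (Fin 5)) ∧
      ¬ Nonempty (G ≃* alternatingGroup (Fin 5) × Multiplicative (ZMod 2))) ∧
    (∀ G : Subgroup (GL (Fin 2) k),
      IsCentralExtensionByCyclic 2 G (alternatingGroup (Fin 5)) → IsMinAbelianIndex G 12) ∧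
    -- `PGL₂(k)` contains an `A₅`, and every `A₅` in it attains the constant
    (∃ G : Subgroup PGL(2, k), Nonempty (G ≃* alternatingGroup (Fin 5))) ∧
    (∀ G : Subgroup PGL(2, k),
      Nonempty (G ≃* alternatingGroup (Fin 5)) → IsMinAbelianIndex G 12) := by
  obtain ⟨f⟩ := BinaryIcosahedral.nonempty_coeff_ringHom (k := k)
  let e := MonoidHom.ofInjective (BinaryIcosahedral.toGL_injective f)
  have hG := BinaryIcosahedral.isCentralExtension.of_mulEquiv e.symm
  let ρ := Matrix.ProjGenLinGroup.mk.comp (BinaryIcosahedral.toGL f)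
  -- Both sides are quotients of the binary icosahedral group by the same kernel.
  let e' : ρ.range ≃* alternatingGroup (Fin 5) :=
    (QuotientGroup.quotientKerEquivRange ρ).symm.trans
      ((QuotientGroup.quotientMulEquivOfEq (BinaryIcosahedral.ker_mk_comp_toGL f)).trans
        (QuotientGroup.quotientKerEquivOfSurjective _
          BinaryIcosahedral.toAlternating_surjective))
  refine ⟨?_, ?_, ⟨_, hG, fun ⟨e'⟩ ↦ ?_⟩, fun G hG ↦ ?_, ⟨_, ⟨e'⟩⟩, fun G ⟨e⟩ ↦ ?_⟩
  · have := hG.finite two_ne_zero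
    obtain ⟨φ, hφ, -⟩ := hG
    exact isWeakJordanBound_GL.isWeakJordanConstant hφ
  · have := Finite.of_equiv _ e'.symm.toEquiv
    exact isWeakJordanBound_PGL.isWeakJordanConstant (φ := e'.toMonoidHom) e'.surjective
  · exact BinaryIcosahedral.not_nonempty_mulEquiv_prod ⟨e.trans e'⟩
  · have := hG.finite two_ne_zero
    obtain ⟨φ, hφ, -⟩ := hG
    exact isWeakJordanBound_GL.isMinAbelianIndex hφ
  · have := Finite.of_equiv _ e.symm.toEquiv
    exact isWeakJordanBound_PGL.isMinAbelianIndex (φ := e.toMonoidHom) e.surjective
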